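/- Let $W=C_0([0,1])$ be the space of real continuous functions on $[0,1]$ vanishing at $0$, with the supremum norm and its Borel $\sigma$-algebra, and let $\mu$ be the Wiener measure on $W$. Let $H$ be the Cameron–Martin space, i.e. the space of absolutely continuous $h:[0,1]\to\mathbb{R}$ with $h(0)=0$ and $h'\in L^2([0,1])$, with inner product $(h,k)_H=\int_0^1 h'(s)k'(s)\,ds$. For $h\in H$ let $\delta h=\int_0^1 h'(s)\,dw(s)\in L^2(\mu)$ be its Wiener integral. Let $R:H\to H$ be a unitary operator (a surjective linear isometry of the real Hilbert space $H$), let $(e_i)_{i\in\mathbb{N}}$ be a complete orthonormal basis of $H$, and let $T:W\to W$ be the measurable transformation, determined up to a $\mu$-null set, given by $$Tw=\sum_{i}\delta(Re_i)(w)\,e_i ,$$ where the series converges uniformly on $[0,1]$ for $\mu$-almost every $w$. Then $T$ is mixing, that is, $T$ preserves $\mu$ and $\mu(T^{-n}A\cap B)\to\mu(A)\mu(B)$ as $n\to\infty$ for all Borel sets $A,B\subseteq W$, if and only if $$\lim_{n\to\infty}(R^nh,h)_H=0\quad\text{for every } h\in H .$$ -/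

import Mathlib

open MeasureTheory ProbabilityTheory Filter Topology

noncomputable section

namespace WienerRotation

/-! ### The path space -/

/-- The space `C₀([0,1])` of real continuous functions on `[0,1]` vanishing at `0`,
with the supremum norm. -/
def pathSubmodule : Submodule ℝ C(unitInterval, ℝ) where
  carrier := {w | w 0 = 0}
  add_mem' {a b} ha hb := by
    simp only [Set.mem_ofPred_eq, ContinuousMap.add_apply] at ha hb ⊢
    rw [ha, hb, add_zero]
  zero_mem' := rfl
  smul_mem' c a ha := by
    simp only [Set.mem_ofPred_eq, ContinuousMap.smul_apply] at ha ⊢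
    rw [ha, smul_zero]

abbrev Path0 : Type := pathSubmodule

instance : MeasurableSpace Path0 := borel Path0

instance : BorelSpace Path0 := ⟨rfl⟩

/-- The value `w_t` of a path. -/
def coord (t : unitInterval) (w : Path0) : ℝ := w.1 t

/-- `μ` is the Wiener measure: under `μ` the coordinate process (which has continuous paths
starting from `0`) is a centered Gaussian process with covariance `min s t`. -/
structure IsWienerMeasure (μ : Measure Path0) : Prop where
  isGaussianProcess : IsGaussianProcess coord μ
  integral_coord : ∀ t, ∫ w, coord t w ∂μ = 0
  integral_coord_mul_coord : ∀ s t : unitInterval,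
    ∫ w, coord s w * coord t w ∂μ = min (s : ℝ) (t : ℝ)

/-! ### The Cameron-Martin space -/

/-- A path as a function on the real line, constant outside of `[0,1]`. -/
def ext (w : Path0) : ℝ → ℝ := Set.IccExtend zero_le_one w.1

/-- Lebesgue measure on `[0,1]`. -/
abbrev leb : Measure ℝ := volume.restrict (Set.Icc 0 1)

theorem ae_differentiableAt {h : Path0} (hh : AbsolutelyContinuousOnInterval (ext h) 0 1) :
    ∀ᵐ t ∂leb, DifferentiableAt ℝ (ext h) t := by
  rw [ae_restrict_iff' measurableSet_Icc]
  filter_upwards [hh.ae_differentiableAt] with t ht h1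
  exact ht (by rwa [Set.uIcc_of_le zero_le_one])

/-- Absolutely continuous functions on `[0,1]`, vanishing at `0`, with square integrable
derivative. -/
def cameronMartin : Submodule ℝ Path0 where
  carrier := {h | AbsolutelyContinuousOnInterval (ext h) 0 1 ∧ MemLp (deriv (ext h)) 2 leb}
  add_mem' {a b} ha hb := by
    refine ⟨ha.1.add hb.1, (ha.2.add hb.2).ae_eq ?_⟩
    filter_upwards [ae_differentiableAt ha.1, ae_differentiableAt hb.1] with t h1 h2
    exact (deriv_add h1 h2).symm
  zero_mem' := by
    have h0 : ext 0 = fun _ => (0 : ℝ) := rfl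
    constructor
    · rw [h0]
      exact (contDiff_const (n := 1)).contDiffOn.absolutelyContinuousOnInterval
    · rw [h0, deriv_const']
      exact MemLp.zero
  smul_mem' c a ha := by
    refine ⟨ha.1.const_mul c, (ha.2.const_mul c).ae_eq ?_⟩
    filter_upwards [ae_differentiableAt ha.1] with t h1
    exact (deriv_const_mul c h1).symm

/-- The Cameron-Martin space `H`. It is a separate type, so that it carries its Hilbert norm and
not the supremum norm. -/
def H : Type := cameronMartin

instance : AddCommGroup H := inferInstanceAs (AddCommGroup cameronMartin)

instance : Module ℝ H := inferInstanceAs (Module ℝ cameronMartin)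

/-- The inclusion of `H` into the path space. -/
def H.toPath : H →ₗ[ℝ] Path0 := cameronMartin.subtype

theorem H.absolutelyContinuous (h : H) : AbsolutelyContinuousOnInterval (ext h.toPath) 0 1 :=
  h.2.1

theorem H.memLp_deriv (h : H) : MemLp (deriv (ext h.toPath)) 2 leb := h.2.2

/-- The map `h ↦ h'` from `H` to `L²([0,1])`. -/
def H.derivLp : H →ₗ[ℝ] Lp ℝ 2 leb where
  toFun h := h.memLp_deriv.toLp
  map_add' a b := by
    refine Eq.trans ?_ (MemLp.toLp_add a.memLp_deriv b.memLp_deriv)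
    rw [MemLp.toLp_eq_toLp_iff]
    filter_upwards [ae_differentiableAt a.absolutelyContinuous,
      ae_differentiableAt b.absolutelyContinuous] with t h1 h2
    exact deriv_add h1 h2
  map_smul' c a := by
    refine Eq.trans ?_ (MemLp.toLp_const_smul c a.memLp_deriv)
    rw [MemLp.toLp_eq_toLp_iff]
    filter_upwards [ae_differentiableAt a.absolutelyContinuous] with t h1
    exact deriv_const_mul c h1

theorem H.coeFn_derivLp (h : H) : h.derivLp =ᵐ[leb] deriv (ext h.toPath) :=
  MemLp.coeFn_toLp h.memLp_deriv

theorem H.derivLp_injective : Function.Injective H.derivLp := by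
  rw [← LinearMap.ker_eq_bot, LinearMap.ker_eq_bot']
  intro h hh
  have h0 : ∀ᵐ t ∂leb, deriv (ext h.toPath) t = 0 := by
    have h1 := h.coeFn_derivLp
    rw [hh] at h1
    filter_upwards [h1, Lp.coeFn_zero ℝ 2 leb] with t h2 h3
    rw [← h2, h3, Pi.zero_apply]
  rw [ae_restrict_iff' measurableSet_Icc] at h0
  apply Subtype.ext
  apply Subtype.ext
  ext t
  have hac : AbsolutelyContinuousOnInterval (ext h.toPath) 0 t := by
    refine h.absolutelyContinuous.mono ?_
    rw [Set.uIcc_of_le zero_le_one, Set.uIcc_of_le t.2.1]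
    exact Set.Icc_subset_Icc le_rfl t.2.2
  have h1 := hac.integral_deriv_eq_sub
  rw [intervalIntegral.integral_zero_ae] at h1
  · have h2 : ext h.toPath t = h.toPath.1 t := Set.IccExtend_val _ _ t
    have h3 : ext h.toPath 0 = h.toPath.1 0 := Set.IccExtend_val _ _ (0 : unitInterval)
    have h4 : h.toPath.1 0 = 0 := h.toPath.2
    have h5 : h.toPath.1 t = 0 := by linarith
    exact h5
  · filter_upwards [h0] with s hs h6
    rw [Set.uIoc_of_le t.2.1] at h6
    exact hs ⟨h6.1.le, h6.2.trans t.2.2⟩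

/-- The norm of `H` is `|h|_H = ‖h'‖` and its inner product is `(h, k)_H = ∫₀¹ h' k'`. -/
instance : NormedAddCommGroup H :=
  NormedAddCommGroup.induced H (Lp ℝ 2 leb) H.derivLp H.derivLp_injective

instance : InnerProductSpace ℝ H := InnerProductSpace.induced H.derivLp

theorem H.inner_eq (h k : H) :
    inner ℝ h k = ∫ t in (0 : ℝ)..1, deriv (ext h.toPath) t * deriv (ext k.toPath) t := by
  have h1 : inner ℝ h k = inner ℝ h.derivLp k.derivLp := rfl
  rw [h1, L2.inner_def, intervalIntegral.integral_of_le zero_le_one,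
    ← integral_Icc_eq_integral_Ioc]
  refine integral_congr_ae ?_
  filter_upwards [h.coeFn_derivLp, k.coeFn_derivLp] with t h2 h3
  rw [h2, h3]
  exact mul_comm _ _

/-! ### The Wiener integral -/

/-- The indicator function of `[0,t]` in `L²([0,1])`. -/
def indIcc (t : unitInterval) : Lp ℝ 2 leb :=
  indicatorConstLp 2 (measurableSet_Icc (a := (0 : ℝ)) (b := t)) (measure_ne_top leb _) (1 : ℝ)

/-- The step function `∑ aᵢ 1_[0,tᵢ]` in `L²([0,1])`. -/
def stepLp : (unitInterval →₀ ℝ) →ₗ[ℝ] Lp ℝ 2 leb := Finsupp.linearCombination ℝ indIcc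

variable {μ : Measure Path0}

theorem IsWienerMeasure.memLp_coord (hμ : IsWienerMeasure μ) (t : unitInterval) :
    MemLp (coord t) 2 μ :=
  (hμ.isGaussianProcess.hasGaussianLaw_eval t).memLp_two

/-- The random variable `w_t` in `L²(μ)`. -/
def coordLp (hμ : IsWienerMeasure μ) (t : unitInterval) : Lp ℝ 2 μ := (hμ.memLp_coord t).toLp

/-- The elementary integral `∑ aᵢ w_{tᵢ}` of the step function `∑ aᵢ 1_[0,tᵢ]`. -/
def stepIntegral (hμ : IsWienerMeasure μ) : (unitInterval →₀ ℝ) →ₗ[ℝ] Lp ℝ 2 μ :=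
  Finsupp.linearCombination ℝ (coordLp hμ)

/-- The Wiener integral `f ↦ ∫₀¹ f(s) dw(s)`: the continuous extension to `L²([0,1])` of the
elementary integral of step functions. -/
def wienerIntegral (hμ : IsWienerMeasure μ) : Lp ℝ 2 leb →L[ℝ] Lp ℝ 2 μ :=
  (stepIntegral hμ).extendOfNorm stepLp

/-- `δh = ∫₀¹ h'(s) dw(s)`. -/
def delta (hμ : IsWienerMeasure μ) (h : H) : Lp ℝ 2 μ := wienerIntegral hμ h.derivLp

theorem inner_indIcc (s t : unitInterval) :
    inner ℝ (indIcc s) (indIcc t) = min (s : ℝ) (t : ℝ) := by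
  rw [indIcc, indIcc, L2.real_inner_indicatorConstLp_one_indicatorConstLp_one, measureReal_def,
    Measure.restrict_apply (measurableSet_Icc.inter measurableSet_Icc)]
  have h : Set.Icc (0 : ℝ) s ∩ Set.Icc 0 t ∩ Set.Icc 0 1 = Set.Icc 0 (min (s : ℝ) t) := by
    ext x
    have := s.2.2
    simp only [Set.mem_inter_iff, Set.mem_Icc, le_min_iff]
    grind
  rw [h, Real.volume_Icc, sub_zero, ENNReal.toReal_ofReal (le_min s.2.1 t.2.1)]

theorem inner_coordLp (hμ : IsWienerMeasure μ) (s t : unitInterval) :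
    inner ℝ (coordLp hμ s) (coordLp hμ t) = min (s : ℝ) (t : ℝ) := by
  rw [← hμ.integral_coord_mul_coord s t, L2.inner_def]
  refine integral_congr_ae ?_
  filter_upwards [(hμ.memLp_coord s).coeFn_toLp, (hμ.memLp_coord t).coeFn_toLp] with w h1 h2
  rw [coordLp, coordLp, h1, h2]
  exact mul_comm _ _

theorem norm_stepIntegral (hμ : IsWienerMeasure μ) (a : unitInterval →₀ ℝ) :
    ‖stepIntegral hμ a‖ = ‖stepLp a‖ := by
  have h : inner ℝ (stepIntegral hμ a) (stepIntegral hμ a) = inner ℝ (stepLp a) (stepLp a) := by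
    simp only [stepIntegral, stepLp, Finsupp.linearCombination_apply, Finsupp.sum, sum_inner,
      inner_sum, real_inner_smul_left, real_inner_smul_right, inner_coordLp, inner_indIcc]
  rw [real_inner_self_eq_norm_sq, real_inner_self_eq_norm_sq] at h
  exact (sq_eq_sq₀ (norm_nonneg _) (norm_nonneg _)).1 h

theorem denseRange_stepLp : DenseRange stepLp := by
  have h : (LinearMap.range stepLp).topologicalClosure = ⊤ := by
    rw [Submodule.topologicalClosure_eq_top_iff, Submodule.eq_bot_iff]
    intro g hg
    have hg1 : ∀ t ∈ Set.Icc (0 : ℝ) 1, ∫ x in (0 : ℝ)..t, g x = 0 := by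
      intro t ht
      have h1 : inner ℝ (indIcc ⟨t, ht⟩) g = 0 := by
        refine (Submodule.mem_orthogonal _ _).1 hg _ ⟨Finsupp.single ⟨t, ht⟩ 1, ?_⟩
        rw [stepLp, Finsupp.linearCombination_single, one_smul]
      rw [indIcc, L2.inner_indicatorConstLp_one, Measure.restrict_restrict measurableSet_Icc,
        Set.inter_eq_left.2 (Set.Icc_subset_Icc le_rfl ht.2), integral_Icc_eq_integral_Ioc] at h1
      rw [intervalIntegral.integral_of_le ht.1, h1]
    have hi : IntervalIntegrable g volume 0 1 := by
      rw [intervalIntegrable_iff_integrableOn_Icc_of_le zero_le_one]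
      exact (Lp.memLp g).integrable one_le_two
    rw [Lp.eq_zero_iff_ae_eq_zero]
    suffices key : ∀ᵐ x ∂(volume.restrict (Set.Icc (0 : ℝ) 1)), g x = 0 from key
    rw [Measure.restrict_congr_set Ioo_ae_eq_Icc.symm, ae_restrict_iff' measurableSet_Ioo]
    filter_upwards [hi.ae_hasDerivAt_integral] with t h1 h2
    rw [Set.uIcc_of_le zero_le_one] at h1
    have h3 := h1 (Set.Ioo_subset_Icc_self h2) 0 (Set.left_mem_Icc.2 zero_le_one)
    refine h3.unique ((hasDerivAt_const t (0 : ℝ)).congr_of_eventuallyEq ?_)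
    filter_upwards [Icc_mem_nhds h2.1 h2.2] with u hu using hg1 u hu
  have h1 : closure (Set.range stepLp) = Set.univ := by
    rw [← LinearMap.coe_range, ← Submodule.topologicalClosure_coe, h, Submodule.top_coe]
  exact dense_iff_closure_eq.2 h1

theorem wienerIntegral_stepLp (hμ : IsWienerMeasure μ) (a : unitInterval →₀ ℝ) :
    wienerIntegral hμ (stepLp a) = stepIntegral hμ a :=
  LinearMap.extendOfNorm_eq denseRange_stepLp
    ⟨1, fun x => by rw [one_mul, norm_stepIntegral]⟩ a

/-! ### Rotations and mixing -/

/-- `T` is the transformation `T w = ∑ᵢ δ(R eᵢ)(w) eᵢ`, where the series converges uniformly on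
`[0,1]` for almost every path `w`. This determines `T` up to a `μ`-null set. -/
structure IsRotation (hμ : IsWienerMeasure μ) (R : H ≃ₗᵢ[ℝ] H) (e : HilbertBasis ℕ ℝ H)
    (T : Path0 → Path0) : Prop where
  measurable : Measurable T
  tendsto : ∀ᵐ w ∂μ, Tendsto
    (fun N => ∑ i ∈ Finset.range N, (delta hμ (R (e i)) : Path0 → ℝ) w • (e i).toPath)
    atTop (𝓝 (T w))

/-- `T` is a (strongly) mixing measure preserving transformation of `(Ω, μ)`. -/
structure IsMixing {Ω : Type*} [MeasurableSpace Ω] (T : Ω → Ω) (μ : Measure Ω) : Prop where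
  measurePreserving : MeasurePreserving T μ μ
  tendsto : ∀ A B : Set Ω, MeasurableSet A → MeasurableSet B →
    Tendsto (fun n : ℕ => μ ((T^[n]) ⁻¹' A ∩ B)) atTop (𝓝 (μ A * μ B))

end WienerRotation

end

/-! The map `h ↦ δh` embeds `H` isometrically into `L²(μ)` as a space of centered Gaussian
variables, and composition with `T` acts on it as `R`: `δh ∘ T = δ(Rh)`
(`IsRotation.compMeasurePreserving_deltaIsometry`). Since `R` preserves norms, the characteristic
functions are unchanged and `T` preserves `μ`.

If `T` is mixing, correlations decay for all pairs in `L²(μ)`. For `δh` with itself, the `n`-th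
correlation is `(Rⁿh, h)` and the product of the means is `0`, so `(Rⁿh, h) → 0`.

Conversely, `(Rⁿh, h) → 0` for all `h` implies `(Rⁿh, k) → 0` for all `h, k`
(`tendsto_inner_pow_of_tendsto_inner_self`). The correlation of `exp(iδh) ∘ Tⁿ` and `exp(iδk)` is
`exp(-‖k - Rⁿh‖²/2)`; only the cross term in the exponent depends on `n`, so the limit is
`exp(-‖h‖²/2) exp(-‖k‖²/2)`, the product of the means. The exponentials are total in complex `L²(μ)`
(`span_expDelta_dense`), and decay of correlations passes from a total set to the whole space
(`tendsto_inner_of_span_dense`), in particular to indicators. -/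

namespace WienerRotation

/-! ### The reproducing kernel of the Cameron-Martin space -/

/-- The path `s ↦ min s t`. -/
noncomputable def minPath (t : unitInterval) : Path0 :=
  ⟨⟨fun s => min (s : ℝ) t, by fun_prop⟩, min_eq_left t.2.1⟩

theorem ext_minPath (t : unitInterval) {s : ℝ} (hs : s ∈ Set.Icc (0 : ℝ) 1) :
    ext (minPath t) s = min s t :=
  Set.IccExtend_of_mem _ _ hs

theorem absolutelyContinuous_minPath (t : unitInterval) :
    AbsolutelyContinuousOnInterval (ext (minPath t)) 0 1 := by
  refine LipschitzOnWith.absolutelyContinuousOnInterval (K := 1) ?_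
  rw [Set.uIcc_of_le zero_le_one]
  refine LipschitzOnWith.of_dist_le_mul fun x hx y hy => ?_
  rw [ext_minPath t hx, ext_minPath t hy, NNReal.coe_one, one_mul]
  exact (LipschitzWith.id.min_const (t : ℝ)).dist_le_mul x y |>.trans (by simp)

theorem deriv_minPath (t : unitInterval) :
    deriv (ext (minPath t)) =ᵐ[leb] (Set.Icc (0 : ℝ) t).indicator fun _ => (1 : ℝ) := by
  have hIoo : leb = volume.restrict (Set.Ioo 0 1) :=
    Measure.restrict_congr_set Ioo_ae_eq_Icc.symm
  rw [Filter.EventuallyEq, hIoo, ae_restrict_iff' measurableSet_Ioo]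
  -- The endpoints of `[0,1]` and the kink at `t` form a null set.
  have hne : ∀ᵐ s : ℝ, s ≠ t := by simp [ae_iff]
  filter_upwards [hne] with s hs h01
  have hev : ext (minPath t) =ᶠ[𝓝 s] fun s => min s (t : ℝ) := by
    filter_upwards [Icc_mem_nhds h01.1 h01.2] with u hu using ext_minPath t hu
  rw [hev.deriv_eq]
  rcases lt_or_gt_of_ne hs with h | h
  · have h1 : (fun s => min s (t : ℝ)) =ᶠ[𝓝 s] id := by
      filter_upwards [Iio_mem_nhds h] with u hu using min_eq_left (le_of_lt hu)
    rw [h1.deriv_eq, deriv_id, Set.indicator_of_mem (Set.mem_Icc.2 ⟨h01.1.le, h.le⟩)]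
  · have h1 : (fun s => min s (t : ℝ)) =ᶠ[𝓝 s] fun _ => (t : ℝ) := by
      filter_upwards [Ioi_mem_nhds h] with u hu using min_eq_right (le_of_lt hu)
    rw [h1.deriv_eq, deriv_const, Set.indicator_of_notMem fun h2 => h.not_ge h2.2]

/-- The element `s ↦ min s t` of the Cameron-Martin space, which represents the evaluation
at `t`. -/
noncomputable def ker (t : unitInterval) : H :=
  (⟨minPath t, absolutelyContinuous_minPath t,
    (memLp_indicator_const 2 measurableSet_Icc (1 : ℝ) (Or.inr (measure_ne_top leb _))).ae_eq
      (deriv_minPath t).symm⟩ : cameronMartin)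

theorem derivLp_ker (t : unitInterval) : (ker t).derivLp = indIcc t := by
  refine Lp.ext ((ker t).coeFn_derivLp.trans ((deriv_minPath t).trans ?_))
  exact indicatorConstLp_coeFn.symm

/-- Since the derivative of `ker t` is `1_[0,t]`, this is the fundamental theorem of calculus for
`h` on `[0,t]`, with `h(0) = 0`. -/
theorem inner_ker (t : unitInterval) (h : H) : inner ℝ (ker t) h = h.toPath.1 t := by
  have h1 : inner ℝ (ker t) h = inner ℝ (ker t).derivLp h.derivLp := rfl
  have hac : AbsolutelyContinuousOnInterval (ext h.toPath) 0 t := by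
    refine h.absolutelyContinuous.mono ?_
    rw [Set.uIcc_of_le zero_le_one, Set.uIcc_of_le t.2.1]
    exact Set.Icc_subset_Icc le_rfl t.2.2
  rw [h1, derivLp_ker, indIcc, L2.inner_indicatorConstLp_one,
    Measure.restrict_restrict measurableSet_Icc,
    Set.inter_eq_left.2 (Set.Icc_subset_Icc le_rfl t.2.2)]
  have h2 : ∫ x in Set.Icc (0 : ℝ) t, h.derivLp x
      = ∫ x in Set.Icc (0 : ℝ) t, deriv (ext h.toPath) x := by
    refine integral_congr_ae (ae_mono (Measure.restrict_mono ?_ le_rfl) h.coeFn_derivLp)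
    exact Set.Icc_subset_Icc le_rfl t.2.2
  rw [h2, integral_Icc_eq_integral_Ioc, ← intervalIntegral.integral_of_le t.2.1,
    hac.integral_deriv_eq_sub]
  have h3 : ext h.toPath t = h.toPath.1 t := Set.IccExtend_val _ _ t
  have h4 : ext h.toPath 0 = h.toPath.1 0 := Set.IccExtend_val _ _ (0 : unitInterval)
  have h5 : h.toPath.1 0 = 0 := h.toPath.2
  rw [h3, h4, h5, sub_zero]

/-- The finite linear combinations of evaluation kernels. -/
noncomputable def kerSum : (unitInterval →₀ ℝ) →ₗ[ℝ] H := Finsupp.linearCombination ℝ ker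

theorem derivLp_kerSum (a : unitInterval →₀ ℝ) : (kerSum a).derivLp = stepLp a := by
  simp only [kerSum, stepLp, Finsupp.linearCombination_apply, Finsupp.sum, map_sum, map_smul,
    derivLp_ker]

theorem isometry_derivLp : Isometry H.derivLp :=
  AddMonoidHomClass.isometry_of_norm _ fun _ => rfl

/-- Density of step functions pulls back along the isometry `h ↦ h'`, whose surjectivity is not
needed. -/
theorem denseRange_kerSum : DenseRange kerSum := by
  intro h
  rw [isometry_derivLp.isUniformInducing.isInducing.closure_eq_preimage_closure_image, Set.mem_preimage,
    ← Set.range_comp]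
  have h1 : H.derivLp ∘ kerSum = stepLp := funext derivLp_kerSum
  rw [h1]
  exact denseRange_stepLp _

/-! ### The Wiener integral as an isometry -/

variable {μ : Measure Path0}

theorem norm_wienerIntegral (hμ : IsWienerMeasure μ) (f : Lp ℝ 2 leb) :
    ‖wienerIntegral hμ f‖ = ‖f‖ := by
  refine denseRange_stepLp.induction_on f
    (isClosed_eq (wienerIntegral hμ).continuous.norm continuous_norm) fun a => ?_
  rw [wienerIntegral_stepLp, norm_stepIntegral]

/-- The map `h ↦ δh` as a linear isometry. -/
noncomputable def deltaIsometry (hμ : IsWienerMeasure μ) : H →ₗᵢ[ℝ] Lp ℝ 2 μ where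
  toLinearMap := (wienerIntegral hμ).toLinearMap ∘ₗ H.derivLp
  norm_map' h := norm_wienerIntegral hμ h.derivLp

theorem deltaIsometry_apply (hμ : IsWienerMeasure μ) (h : H) : deltaIsometry hμ h = delta hμ h :=
  rfl

theorem deltaIsometry_kerSum (hμ : IsWienerMeasure μ) (a : unitInterval →₀ ℝ) :
    deltaIsometry hμ (kerSum a) = stepIntegral hμ a := by
  rw [deltaIsometry_apply, delta, derivLp_kerSum, wienerIntegral_stepLp]

/-- The linear functional `a ↦ ∑ aᵢ w_{tᵢ}`, as a bilinear function of the path `w` and of `a`. -/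
noncomputable def evalSum : Path0 →ₗ[ℝ] (unitInterval →₀ ℝ) →ₗ[ℝ] ℝ where
  toFun w := Finsupp.linearCombination ℝ fun t => coord t w
  map_add' v w := by
    ext t
    simp [coord]
  map_smul' c w := by
    ext t
    simp [coord]

theorem evalSum_single (w : Path0) (t : unitInterval) (c : ℝ) :
    evalSum w (Finsupp.single t c) = c * coord t w :=
  Finsupp.linearCombination_single _ _ _

theorem continuous_coord (t : unitInterval) : Continuous (coord t) :=
  (continuous_eval_const t).comp continuous_subtype_val

theorem continuous_evalSum (a : unitInterval →₀ ℝ) : Continuous fun w => evalSum w a :=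
  continuous_finsetSum a.support fun t _ => (continuous_coord t).const_smul (a t)

theorem coeFn_stepIntegral (hμ : IsWienerMeasure μ) (a : unitInterval →₀ ℝ) :
    stepIntegral hμ a =ᵐ[μ] fun w => evalSum w a := by
  induction a using Finsupp.induction_linear with
  | zero =>
    simp only [map_zero]
    exact Lp.coeFn_zero ℝ 2 μ
  | add a b ha hb =>
    rw [map_add]
    filter_upwards [Lp.coeFn_add (stepIntegral hμ a) (stepIntegral hμ b), ha, hb]
      with w h1 h2 h3
    rw [h1, Pi.add_apply, h2, h3, map_add]
  | single t c =>
    rw [stepIntegral, Finsupp.linearCombination_single]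
    filter_upwards [Lp.coeFn_smul c (coordLp hμ t), (hμ.memLp_coord t).coeFn_toLp] with w h1 h2
    rw [h1, Pi.smul_apply, coordLp, h2, evalSum_single, smul_eq_mul]

/-! ### Gaussian laws and characteristic functions -/

theorem hasGaussianLaw_evalSum (hμ : IsWienerMeasure μ) (a : unitInterval →₀ ℝ) :
    HasGaussianLaw (fun w => evalSum w a) μ :=
  (hμ.isGaussianProcess.smul a).hasGaussianLaw_fun_sum

theorem integral_evalSum (hμ : IsWienerMeasure μ) (a : unitInterval →₀ ℝ) :
    ∫ w, evalSum w a ∂μ = 0 := by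
  have := hμ.isGaussianProcess.isProbabilityMeasure
  induction a using Finsupp.induction_linear with
  | zero => simp
  | add a b ha hb =>
    simp only [map_add]
    rw [integral_add (hasGaussianLaw_evalSum hμ a).integrable
      (hasGaussianLaw_evalSum hμ b).integrable, ha, hb, add_zero]
  | single t c => simp only [evalSum_single, integral_const_mul, hμ.integral_coord, mul_zero]

theorem integral_evalSum_sq (hμ : IsWienerMeasure μ) (a : unitInterval →₀ ℝ) :
    ∫ w, evalSum w a ^ 2 ∂μ = ‖kerSum a‖ ^ 2 := by
  rw [← (deltaIsometry hμ).norm_map, deltaIsometry_kerSum, ← real_inner_self_eq_norm_sq,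
    L2.inner_def]
  refine integral_congr_ae ?_
  filter_upwards [coeFn_stepIntegral hμ a] with w hw
  rw [hw, real_inner_self_eq_norm_sq, Real.norm_eq_abs, sq_abs]

theorem map_evalSum (hμ : IsWienerMeasure μ) (a : unitInterval →₀ ℝ) :
    μ.map (fun w => evalSum w a) = gaussianReal 0 (‖kerSum a‖ ^ 2).toNNReal := by
  rw [(hasGaussianLaw_evalSum hμ a).map_eq_gaussianReal, integral_evalSum hμ,
    variance_of_integral_eq_zero (continuous_evalSum a).aemeasurable (integral_evalSum hμ a),
    integral_evalSum_sq hμ]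

theorem integral_exp_evalSum (hμ : IsWienerMeasure μ) (a : unitInterval →₀ ℝ) :
    ∫ w, Complex.exp (evalSum w a * Complex.I) ∂μ = Complex.exp (-(‖kerSum a‖ ^ 2 / 2 : ℝ)) := by
  have h := charFun_gaussianReal (μ := 0) (v := (‖kerSum a‖ ^ 2).toNNReal) 1
  rw [← map_evalSum hμ, charFun_apply_real, integral_map (continuous_evalSum a).aemeasurable
    (by fun_prop)] at h
  simp only [Complex.ofReal_one, one_mul] at h
  rw [h, Real.coe_toNNReal _ (sq_nonneg _)]
  push_cast
  ring_nf

/-- The characteristic function at `1` of a random variable in `L²` is `1`-Lipschitz. -/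
theorem norm_integral_exp_sub_le [IsProbabilityMeasure μ] (f g : Lp ℝ 2 μ) :
    ‖(∫ w, Complex.exp (f w * Complex.I) ∂μ) - ∫ w, Complex.exp (g w * Complex.I) ∂μ‖
      ≤ ‖f - g‖ := by
  have hint (u : Lp ℝ 2 μ) : Integrable (fun w => Complex.exp (u w * Complex.I)) μ := by
    refine Integrable.of_bound (C := 1) ?_ (ae_of_all _ fun w => ?_)
    · have := (Lp.aestronglyMeasurable u).aemeasurable
      fun_prop
    · rw [Complex.norm_exp_ofReal_mul_I]
  have hexp (x y : ℝ) :
      ‖Complex.exp (x * Complex.I) - Complex.exp (y * Complex.I)‖ ≤ ‖x - y‖ := by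
    have h1 : Complex.exp (x * Complex.I) - Complex.exp (y * Complex.I)
        = Complex.exp (y * Complex.I) * (Complex.exp (Complex.I * (x - y : ℝ)) - 1) := by
      rw [mul_sub, ← Complex.exp_add, mul_one]
      push_cast
      ring_nf
    rw [h1, norm_mul, Complex.norm_exp_ofReal_mul_I, one_mul]
    exact Real.norm_exp_I_mul_ofReal_sub_one_le
  rw [← integral_sub (hint f) (hint g)]
  have hfg : Integrable (f - g : Lp ℝ 2 μ) μ := (Lp.memLp (f - g)).integrable one_le_two
  -- `x ↦ exp(ix)` is `1`-Lipschitz, and the `L¹` norm is at most the `L²` norm for a probability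
  -- measure.
  calc _ ≤ ∫ w, ‖(f - g : Lp ℝ 2 μ) w‖ ∂μ := by
        refine norm_integral_le_of_norm_le hfg.norm ?_
        filter_upwards [Lp.coeFn_sub f g] with w hw
        rw [hw, Pi.sub_apply]
        exact hexp _ _
    _ = (eLpNorm (f - g : Lp ℝ 2 μ) 1 μ).toReal := by
        rw [integral_norm_eq_lintegral_enorm hfg.aestronglyMeasurable,
          eLpNorm_one_eq_lintegral_enorm]
    _ ≤ (eLpNorm (f - g : Lp ℝ 2 μ) 2 μ).toReal :=
        ENNReal.toReal_mono (Lp.eLpNorm_ne_top _)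
          (eLpNorm_le_eLpNorm_of_exponent_le one_le_two hfg.aestronglyMeasurable)
    _ = ‖f - g‖ := rfl

/-- Both sides are continuous in `h` and agree on the dense set of kernel sums, where `δh` is a
finite combination of values of the path. -/
theorem integral_exp_deltaIsometry (hμ : IsWienerMeasure μ) (h : H) :
    ∫ w, Complex.exp (deltaIsometry hμ h w * Complex.I) ∂μ
      = Complex.exp (-(‖h‖ ^ 2 / 2 : ℝ)) := by
  have := hμ.isGaussianProcess.isProbabilityMeasure
  have hlip : LipschitzWith 1
      (fun f : Lp ℝ 2 μ => ∫ w, Complex.exp (f w * Complex.I) ∂μ) :=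
    LipschitzWith.of_dist_le_mul fun f g => by
      rw [dist_eq_norm, dist_eq_norm, NNReal.coe_one, one_mul]
      exact norm_integral_exp_sub_le f g
  refine denseRange_kerSum.induction_on h (isClosed_eq
    (hlip.continuous.comp (deltaIsometry hμ).continuous) (by fun_prop)) fun a => ?_
  rw [← integral_exp_evalSum hμ, deltaIsometry_kerSum]
  refine integral_congr_ae ?_
  filter_upwards [coeFn_stepIntegral hμ a] with w hw
  simp only [hw]

/-- Finite measures on the path space are determined by the characteristic functions of the
finite combinations of values of the path. -/
theorem measure_ext_of_evalSum {ν ν' : Measure Path0} [IsFiniteMeasure ν] [IsFiniteMeasure ν']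
    (h : ∀ a : unitInterval →₀ ℝ, ∫ w, Complex.exp (evalSum w a * Complex.I) ∂ν
      = ∫ w, Complex.exp (evalSum w a * Complex.I) ∂ν') : ν = ν' := by
  -- With the discrete topology on the parameters, joint continuity of the pairing reduces to
  -- continuity in the path.
  let : TopologicalSpace (unitInterval →₀ ℝ) := ⊥
  have : DiscreteTopology (unitInterval →₀ ℝ) := ⟨rfl⟩
  have hclosed : IsClosed (pathSubmodule : Set C(unitInterval, ℝ)) :=
    isClosed_eq (continuous_eval_const 0) continuous_const
  have : CompleteSpace Path0 := hclosed.completeSpace_coe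
  have hcont : Continuous fun p : Path0 × (unitInterval →₀ ℝ) => evalSum p.1 p.2 :=
    continuous_prod_of_discrete_right.2 continuous_evalSum
  refine ext_of_integral_char_eq (L := evalSum) Real.continuous_probChar
    Real.probChar_ne_one (fun w hw h0 => hw ?_) hcont h
  apply Subtype.ext
  ext t
  have h1 := LinearMap.congr_fun h0 (Finsupp.single t 1)
  rwa [evalSum_single, one_mul] at h1

end WienerRotation

namespace WienerRotation

variable {μ : Measure Path0}

/-! ### The action of a rotation on Wiener integrals -/

/-- The coefficients of `ker t` in the basis are `eᵢ(t)`, so `∑ eᵢ(t) δ(R eᵢ)` converges to `δ(R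
(ker t))` in `L²`. The same partial sums are the values at `t` of the series for `T w`, so they also
converge almost surely to `(T w)_t`. -/
theorem IsRotation.coord_comp_ae_eq {hμ : IsWienerMeasure μ} {R : H ≃ₗᵢ[ℝ] H}
    {e : HilbertBasis ℕ ℝ H} {T : Path0 → Path0} (hT : IsRotation hμ R e T) (t : unitInterval) :
    (fun w => coord t (T w)) =ᵐ[μ] deltaIsometry hμ (R (ker t)) := by
  have hsum : Tendsto (fun N => ∑ i ∈ Finset.range N, (e i).toPath.1 t • e i) atTop
      (𝓝 (ker t)) := by
    have h := (e.hasSum_repr (ker t)).tendsto_sum_nat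
    simpa only [HilbertBasis.repr_apply_apply, real_inner_comm (ker t), inner_ker] using h
  have hLp : Tendsto (fun N => ∑ i ∈ Finset.range N, (e i).toPath.1 t • delta hμ (R (e i))) atTop
      (𝓝 (deltaIsometry hμ (R (ker t)))) := by
    have h := (((deltaIsometry hμ).continuous.comp R.continuous).tendsto (ker t)).comp hsum
    refine h.congr fun N => ?_
    simp only [Function.comp_apply, map_sum, map_smul, deltaIsometry_apply]
  -- Convergence in `L²` gives almost sure convergence only along a subsequence, which suffices to
  -- identify the two limits.
  obtain ⟨ns, hns, hae⟩ := (tendstoInMeasure_of_tendsto_Lp hLp).exists_seq_tendsto_ae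
  have hcoe (N : ℕ) : ∀ᵐ w ∂μ,
      (∑ i ∈ Finset.range N, (e i).toPath.1 t • delta hμ (R (e i)) : Lp ℝ 2 μ) w
        = coord t (∑ i ∈ Finset.range N, (delta hμ (R (e i)) : Path0 → ℝ) w • (e i).toPath) := by
    induction N with
    | zero =>
      filter_upwards [Lp.coeFn_zero ℝ 2 μ] with w hw
      simpa [coord] using hw
    | succ N ih =>
      rw [Finset.sum_range_succ]
      filter_upwards [ih, Lp.coeFn_add (∑ i ∈ Finset.range N, (e i).toPath.1 t • delta hμ (R (e i)))
        ((e N).toPath.1 t • delta hμ (R (e N))),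
        Lp.coeFn_smul ((e N).toPath.1 t) (delta hμ (R (e N)))] with w h1 h2 h3
      rw [h2, Pi.add_apply, h1, h3, Finset.sum_range_succ, Pi.smul_apply]
      simp only [coord, Submodule.coe_add, Submodule.coe_smul, ContinuousMap.add_apply,
        ContinuousMap.smul_apply, smul_eq_mul]
      rw [mul_comm]
  filter_upwards [hae, ae_all_iff.2 hcoe, hT.tendsto] with w h1 h2 h3
  have h4 := (((continuous_coord t).tendsto (T w)).comp h3).comp hns.tendsto_atTop
  refine tendsto_nhds_unique h4 (h1.congr fun i => ?_)
  exact h2 (ns i)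

theorem IsRotation.evalSum_comp_ae_eq {hμ : IsWienerMeasure μ} {R : H ≃ₗᵢ[ℝ] H}
    {e : HilbertBasis ℕ ℝ H} {T : Path0 → Path0} (hT : IsRotation hμ R e T)
    (a : unitInterval →₀ ℝ) :
    (fun w => evalSum (T w) a) =ᵐ[μ] deltaIsometry hμ (R (kerSum a)) := by
  induction a using Finsupp.induction_linear with
  | zero =>
    simp only [map_zero]
    exact (Lp.coeFn_zero ℝ 2 μ).symm
  | add a b ha hb =>
    simp only [map_add]
    filter_upwards [Lp.coeFn_add (deltaIsometry hμ (R (kerSum a)))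
      (deltaIsometry hμ (R (kerSum b))), ha, hb] with w h1 h2 h3
    rw [h1, Pi.add_apply, h2, h3]
  | single t c =>
    rw [kerSum, Finsupp.linearCombination_single, map_smul, map_smul]
    filter_upwards [Lp.coeFn_smul c (deltaIsometry hμ (R (ker t))), hT.coord_comp_ae_eq t]
      with w h1 h2
    rw [h1, Pi.smul_apply, evalSum_single, h2, smul_eq_mul]

theorem IsRotation.measurePreserving {hμ : IsWienerMeasure μ} {R : H ≃ₗᵢ[ℝ] H}
    {e : HilbertBasis ℕ ℝ H} {T : Path0 → Path0} (hT : IsRotation hμ R e T) :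
    MeasurePreserving T μ μ := by
  have := hμ.isGaussianProcess.isProbabilityMeasure
  have := Measure.isProbabilityMeasure_map (μ := μ) hT.measurable.aemeasurable
  refine ⟨hT.measurable, measure_ext_of_evalSum fun a => ?_⟩
  have hcont := continuous_evalSum a
  rw [integral_map hT.measurable.aemeasurable (by fun_prop), integral_exp_evalSum hμ a,
    ← R.norm_map (kerSum a), ← integral_exp_deltaIsometry hμ]
  refine integral_congr_ae ?_
  filter_upwards [hT.evalSum_comp_ae_eq a] with w hw
  rw [hw]

/-- Both sides are continuous in `h`; on kernel sums this is `evalSum_comp_ae_eq`. -/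
theorem IsRotation.compMeasurePreserving_deltaIsometry {hμ : IsWienerMeasure μ} {R : H ≃ₗᵢ[ℝ] H}
    {e : HilbertBasis ℕ ℝ H} {T : Path0 → Path0} (hT : IsRotation hμ R e T) (h : H) :
    Lp.compMeasurePreserving T hT.measurePreserving (deltaIsometry hμ h)
      = deltaIsometry hμ (R h) := by
  refine denseRange_kerSum.induction_on h (isClosed_eq
    ((Lp.isometry_compMeasurePreserving hT.measurePreserving).continuous.comp
      (deltaIsometry hμ).continuous)
    ((deltaIsometry hμ).continuous.comp R.continuous)) fun a => ?_
  refine Lp.ext ((Lp.coeFn_compMeasurePreserving _ _).trans ?_)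
  refine EventuallyEq.trans ?_ (hT.evalSum_comp_ae_eq a)
  rw [deltaIsometry_kerSum]
  exact hT.measurePreserving.quasiMeasurePreserving.ae_eq_comp (coeFn_stepIntegral hμ a)

theorem IsRotation.compMeasurePreserving_iterate_deltaIsometry {hμ : IsWienerMeasure μ}
    {R : H ≃ₗᵢ[ℝ] H} {e : HilbertBasis ℕ ℝ H} {T : Path0 → Path0} (hT : IsRotation hμ R e T)
    (n : ℕ) (h : H) :
    Lp.compMeasurePreserving T^[n] (hT.measurePreserving.iterate n) (deltaIsometry hμ h)
      = deltaIsometry hμ ((R ^ n) h) := by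
  rw [← Lp.compMeasurePreserving_iterate hT.measurePreserving]
  induction n generalizing h with
  | zero => rfl
  | succ n ih =>
    rw [Function.iterate_succ_apply, hT.compMeasurePreserving_deltaIsometry, ih, pow_succ]
    rfl

/-! ### Totality of the exponentials -/

/-- The positive and negative parts of `g`, taken as densities, define finite measures with equal
characteristic functions, so they agree almost everywhere; having disjoint supports, they vanish. -/
theorem ae_eq_zero_of_integral_exp_evalSum_mul {g : Path0 → ℝ} (hg : Integrable g μ)
    (h : ∀ a : unitInterval →₀ ℝ, ∫ w, Complex.exp (evalSum w a * Complex.I) * g w ∂μ = 0) :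
    g =ᵐ[μ] 0 := by
  have hfin (f : Path0 → ℝ) (hf : Integrable f μ) :
      IsFiniteMeasure (μ.withDensity fun w => ENNReal.ofReal (f w)) :=
    isFiniteMeasure_withDensity_ofReal hf.2
  have := hfin g hg
  have := hfin (-g) hg.neg
  have hint (f : Path0 → ℝ) (hf : Integrable f μ) (a : unitInterval →₀ ℝ) :
      Integrable (fun w => (ENNReal.ofReal (f w)).toReal •
        Complex.exp (evalSum w a * Complex.I)) μ := by
    have hcont := continuous_evalSum a
    have hpos : Integrable (fun w => (ENNReal.ofReal (f w)).toReal) μ := by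
      simpa only [ENNReal.toReal_ofReal'] using! hf.pos_part
    refine hpos.smul_bdd 1 (by fun_prop) (ae_of_all _ fun w => ?_)
    rw [Complex.norm_exp_ofReal_mul_I]
  have heq : (μ.withDensity fun w => ENNReal.ofReal (g w))
      = μ.withDensity fun w => ENNReal.ofReal ((-g) w) := by
    refine measure_ext_of_evalSum fun a => ?_
    rw [integral_withDensity_eq_integral_toReal_smul₀ hg.1.aemeasurable.ennreal_ofReal
      (by simp), integral_withDensity_eq_integral_toReal_smul₀
      hg.neg.1.aemeasurable.ennreal_ofReal (by simp), ← sub_eq_zero,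
      ← integral_sub (hint g hg a) (hint (-g) hg.neg a), ← h a]
    refine integral_congr_ae (ae_of_all _ fun w => ?_)
    simp only [ENNReal.toReal_ofReal', Pi.neg_apply]
    rw [← sub_smul, max_zero_sub_max_neg_zero_eq_self, Complex.real_smul, mul_comm]
  rw [withDensity_eq_iff hg.1.aemeasurable.ennreal_ofReal hg.neg.1.aemeasurable.ennreal_ofReal
    hg.lintegral_lt_top.ne] at heq
  filter_upwards [heq] with w hw
  have h1 := congrArg ENNReal.toReal hw
  simp only [ENNReal.toReal_ofReal', Pi.neg_apply] at h1
  rw [Pi.zero_apply]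
  grind

theorem memLp_exp_mul_I [IsFiniteMeasure μ] {f : Path0 → ℝ} (hf : AEStronglyMeasurable f μ) :
    MemLp (fun w => Complex.exp (f w * Complex.I)) 2 μ := by
  have := hf.aemeasurable
  refine MemLp.of_bound (C := 1) (AEMeasurable.aestronglyMeasurable (by fun_prop))
    (ae_of_all _ fun w => ?_)
  rw [Complex.norm_exp_ofReal_mul_I]

/-- The function `exp (i δh)` in `L²(μ)`. -/
noncomputable def expDelta [IsFiniteMeasure μ] (hμ : IsWienerMeasure μ) (h : H) : Lp ℂ 2 μ :=
  (memLp_exp_mul_I (Lp.aestronglyMeasurable (deltaIsometry hμ h))).toLp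

theorem coeFn_expDelta [IsFiniteMeasure μ] (hμ : IsWienerMeasure μ) (h : H) :
    expDelta hμ h =ᵐ[μ] fun w => Complex.exp (deltaIsometry hμ h w * Complex.I) :=
  MemLp.coeFn_toLp _

/-- The integrand `conj(exp(iδh)) exp(iδk)` is `exp(iδ(k - h))`, so this is a value of the Gaussian
characteristic function. -/
theorem inner_expDelta [IsFiniteMeasure μ] (hμ : IsWienerMeasure μ) (h k : H) :
    inner ℂ (expDelta hμ h) (expDelta hμ k) = Complex.exp (-(‖k - h‖ ^ 2 / 2 : ℝ)) := by
  rw [← integral_exp_deltaIsometry hμ, L2.inner_def]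
  refine integral_congr_ae ?_
  rw [map_sub]
  filter_upwards [coeFn_expDelta hμ h, coeFn_expDelta hμ k,
    Lp.coeFn_sub (deltaIsometry hμ k) (deltaIsometry hμ h)] with w h1 h2 h3
  rw [h1, h2, h3, RCLike.inner_apply, ← Complex.exp_conj, ← Complex.exp_add, Pi.sub_apply]
  congr 1
  simp only [map_mul, Complex.conj_ofReal, Complex.conj_I]
  push_cast
  ring

/-- For `g` orthogonal to all exponentials, the Fourier integrals of both `g` and its conjugate
vanish, hence those of the real and imaginary parts. -/
theorem span_expDelta_dense [IsFiniteMeasure μ] (hμ : IsWienerMeasure μ) :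
    (Submodule.span ℂ (Set.range (expDelta hμ))).topologicalClosure = ⊤ := by
  rw [Submodule.topologicalClosure_eq_top_iff, Submodule.eq_bot_iff]
  intro g hg
  have hg1 : Integrable g μ := (Lp.memLp g).integrable one_le_two
  have hint (a : unitInterval →₀ ℝ) :
      Integrable (fun w => Complex.exp (evalSum w a * Complex.I) * g w) μ := by
    have hcont := continuous_evalSum a
    refine hg1.bdd_mul (c := 1) (by fun_prop) (ae_of_all _ fun w => ?_)
    rw [Complex.norm_exp_ofReal_mul_I]
  have h0 (a : unitInterval →₀ ℝ) :
      ∫ w, Complex.exp (evalSum w a * Complex.I) * g w ∂μ = 0 := by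
    -- The sign compensates for the conjugation of the first argument.
    have h1 : inner ℂ (expDelta hμ (kerSum (-a))) g = 0 :=
      (Submodule.mem_orthogonal _ _).1 hg _ (Submodule.subset_span ⟨_, rfl⟩)
    rw [L2.inner_def] at h1
    rw [← h1]
    refine integral_congr_ae ?_
    filter_upwards [coeFn_expDelta hμ (kerSum (-a)), deltaIsometry_kerSum hμ (-a) ▸
      coeFn_stepIntegral hμ (-a)] with w h2 h3
    rw [h2, h3, RCLike.inner_apply, ← Complex.exp_conj, mul_comm]
    simp
  have h0' (a : unitInterval →₀ ℝ) :
      ∫ w, Complex.exp (evalSum w a * Complex.I) * (starRingEnd ℂ) (g w) ∂μ = 0 := by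
    rw [← map_zero (starRingEnd ℂ), ← h0 (-a), ← integral_conj]
    refine integral_congr_ae (ae_of_all _ fun w => ?_)
    simp [← Complex.exp_conj]
  have hint' (a : unitInterval →₀ ℝ) :
      Integrable (fun w => Complex.exp (evalSum w a * Complex.I) * (starRingEnd ℂ) (g w)) μ := by
    have hcont := continuous_evalSum a
    refine Integrable.bdd_mul (c := 1) ?_ (by fun_prop) (ae_of_all _ fun w => ?_)
    · exact (LinearIsometryEquiv.integrable_comp_iff Complex.conjLIE).2 hg1
    · rw [Complex.norm_exp_ofReal_mul_I]
  have hre : (fun w => (g w).re) =ᵐ[μ] 0 := by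
    refine ae_eq_zero_of_integral_exp_evalSum_mul hg1.re fun a => ?_
    have h1 : ∫ w, (Complex.exp (evalSum w a * Complex.I) * g w
        + Complex.exp (evalSum w a * Complex.I) * (starRingEnd ℂ) (g w)) / 2 ∂μ = 0 := by
      rw [integral_div, integral_add (hint a) (hint' a), h0, h0', add_zero, zero_div]
    rw [← h1]
    refine integral_congr_ae (ae_of_all _ fun w => ?_)
    simp only [Complex.re_eq_add_conj]
    ring
  have him : (fun w => (g w).im) =ᵐ[μ] 0 := by
    refine ae_eq_zero_of_integral_exp_evalSum_mul hg1.im fun a => ?_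
    have h1 : ∫ w, (Complex.exp (evalSum w a * Complex.I) * g w
        - Complex.exp (evalSum w a * Complex.I) * (starRingEnd ℂ) (g w)) / (2 * Complex.I) ∂μ
        = 0 := by
      rw [integral_div, integral_sub (hint a) (hint' a), h0, h0', sub_zero, zero_div]
    rw [← h1]
    refine integral_congr_ae (ae_of_all _ fun w => ?_)
    simp only [Complex.im_eq_sub_conj]
    ring
  rw [Lp.eq_zero_iff_ae_eq_zero]
  filter_upwards [hre, him] with w h1 h2
  exact Complex.ext h1 h2

end WienerRotation

namespace WienerRotation

/-! ### Weak convergence in Hilbert spaces -/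

section Hilbert

variable {𝕜 E : Type*} [RCLike 𝕜] [NormedAddCommGroup E] [InnerProductSpace 𝕜 E]

/-- For a bounded sequence `x`, the vectors `k` with `⟪x n, k⟫ → 0` form a closed subspace. -/
theorem tendsto_inner_zero_of_mem_closure_span {x : ℕ → E} {C : ℝ} (hx : ∀ n, ‖x n‖ ≤ C)
    {S : Set E} (hS : ∀ k ∈ S, Tendsto (fun n => inner 𝕜 (x n) k) atTop (𝓝 0)) {k : E}
    (hk : k ∈ (Submodule.span 𝕜 S).topologicalClosure) :
    Tendsto (fun n => inner 𝕜 (x n) k) atTop (𝓝 0) := by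
  have hC : 0 ≤ C := (norm_nonneg _).trans (hx 0)
  have hspan : ∀ k ∈ Submodule.span 𝕜 S, Tendsto (fun n => inner 𝕜 (x n) k) atTop (𝓝 0) := by
    intro k hk
    induction hk using Submodule.span_induction with
    | mem k hk => exact hS k hk
    | zero => simp
    | add a b _ _ ha hb => simpa [inner_add_right] using ha.add hb
    | smul c a _ ha => simpa [inner_smul_right] using ha.const_mul c
  rw [Metric.tendsto_atTop]
  intro ε hε
  -- The `+ 1` keeps the denominator positive when `C = 0`.
  obtain ⟨l, hl, hkl⟩ := Metric.mem_closure_iff.1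
    (show k ∈ closure (Submodule.span 𝕜 S : Set E) from hk) (ε / (2 * (C + 1))) (by positivity)
  obtain ⟨N, hN⟩ := Metric.tendsto_atTop.1 (hspan l hl) (ε / 2) (by positivity)
  refine ⟨N, fun n hn => ?_⟩
  have h1 := hN n hn
  rw [dist_zero_right] at h1 ⊢
  have h2 : inner 𝕜 (x n) k = inner 𝕜 (x n) (k - l) + inner 𝕜 (x n) l := by
    rw [← inner_add_right, sub_add_cancel]
  have h3 : ‖inner 𝕜 (x n) (k - l)‖ ≤ C * (ε / (2 * (C + 1))) := by
    refine (norm_inner_le_norm _ _).trans ?_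
    rw [← dist_eq_norm]
    exact mul_le_mul (hx n) hkl.le dist_nonneg hC
  have h4 : C * (ε / (2 * (C + 1))) ≤ ε / 2 := by
    rw [mul_div_assoc', div_le_div_iff₀ (by positivity) (by positivity)]
    nlinarith
  rw [h2]
  linarith [norm_add_le (inner 𝕜 (x n) (k - l)) (inner 𝕜 (x n) l)]

/-- Mixing of a sequence of isometries can be checked on a total set. -/
theorem tendsto_inner_of_span_dense [CompleteSpace E] {U : ℕ → E →ₗᵢ[𝕜] E} {u : E} {S : Set E}
    (hS : (Submodule.span 𝕜 S).topologicalClosure = ⊤)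
    (h : ∀ f ∈ S, ∀ g ∈ S,
      Tendsto (fun n => inner 𝕜 (U n f) g) atTop (𝓝 (inner 𝕜 f u * inner 𝕜 u g)))
    (f g : E) :
    Tendsto (fun n => inner 𝕜 (U n f) g) atTop (𝓝 (inner 𝕜 f u * inner 𝕜 u g)) := by
  -- With `f ∈ S` fixed, the bounded vectors `U n f - ⟪u, f⟫ u` tend weakly to zero against `S`,
  -- hence against everything.
  have hright : ∀ f ∈ S, ∀ g,
      Tendsto (fun n => inner 𝕜 (U n f) g) atTop (𝓝 (inner 𝕜 f u * inner 𝕜 u g)) := by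
    intro f hf g
    have heq (g : E) (n : ℕ) : inner 𝕜 (U n f - inner 𝕜 u f • u) g
        = inner 𝕜 (U n f) g - inner 𝕜 f u * inner 𝕜 u g := by
      rw [inner_sub_left, inner_smul_left, inner_conj_symm]
    have h1 := tendsto_inner_zero_of_mem_closure_span (𝕜 := 𝕜) (S := S) (k := g)
      (x := fun n => U n f - inner 𝕜 u f • u) (C := ‖f‖ + ‖inner 𝕜 u f • u‖)
      (fun n => (norm_sub_le _ _).trans (by rw [(U n).norm_map]))
      (fun k hk => by simpa only [heq, sub_self] using
        (h f hf k hk).sub_const (inner 𝕜 f u * inner 𝕜 u k))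
      (by rw [hS]; trivial)
    simpa only [heq, sub_add_cancel, zero_add] using h1.add_const (inner 𝕜 f u * inner 𝕜 u g)
  -- To free `f` as well, `U n` is moved onto `g` as its adjoint, again of norm at most one, and the
  -- same argument applies.
  have heq (f : E) (n : ℕ) :
      inner 𝕜 ((U n).toContinuousLinearMap.adjoint g - inner 𝕜 u g • u) f
        = inner 𝕜 g (U n f) - inner 𝕜 g u * inner 𝕜 u f := by
    rw [inner_sub_left, inner_smul_left, inner_conj_symm, ContinuousLinearMap.adjoint_inner_left]
    rfl
  have hstar (f : E) (hf : Tendsto (fun n => inner 𝕜 (U n f) g) atTop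
      (𝓝 (inner 𝕜 f u * inner 𝕜 u g))) :
      Tendsto (fun n => inner 𝕜 g (U n f)) atTop (𝓝 (inner 𝕜 g u * inner 𝕜 u f)) := by
    have h1 := (RCLike.continuous_conj.tendsto _).comp hf
    simpa only [Function.comp_def, inner_conj_symm, map_mul, mul_comm] using h1
  have h1 := tendsto_inner_zero_of_mem_closure_span (𝕜 := 𝕜) (S := S) (k := f)
    (x := fun n => (U n).toContinuousLinearMap.adjoint g - inner 𝕜 u g • u)
    (C := ‖g‖ + ‖inner 𝕜 u g • u‖)
    (fun n => by
      refine (norm_sub_le _ _).trans (add_le_add_left ?_ _)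
      refine (ContinuousLinearMap.le_opNorm _ _).trans ?_
      rw [LinearIsometryEquiv.norm_map]
      exact mul_le_of_le_one_left (norm_nonneg _) (U n).norm_toContinuousLinearMap_le)
    (fun k hk => by simpa only [heq, sub_self] using
      (hstar k (hright k hk g)).sub_const (inner 𝕜 g u * inner 𝕜 u k))
    (by rw [hS]; trivial)
  have h2 : Tendsto (fun n => inner 𝕜 g (U n f)) atTop (𝓝 (inner 𝕜 g u * inner 𝕜 u f)) := by
    simpa only [heq, sub_add_cancel, zero_add] using h1.add_const (inner 𝕜 g u * inner 𝕜 u f)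
  have h3 := (RCLike.continuous_conj.tendsto _).comp h2
  simpa only [Function.comp_def, inner_conj_symm, map_mul, mul_comm] using h3

/-- If the correlations `⟪Rⁿ h, h⟫` of a unitary operator tend to zero, then so do all
`⟪Rⁿ h, k⟫`. -/
theorem tendsto_inner_pow_of_tendsto_inner_self [CompleteSpace E] (R : E ≃ₗᵢ[𝕜] E) {h : E}
    (hR : Tendsto (fun n : ℕ => inner 𝕜 ((R ^ n) h) h) atTop (𝓝 0)) (k : E) :
    Tendsto (fun n : ℕ => inner 𝕜 ((R ^ n) h) k) atTop (𝓝 0) := by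
  set S : Set E := Set.range fun m : ℕ => (R ^ m) h with hS
  set K := (Submodule.span 𝕜 S).topologicalClosure with hK
  have hKc : IsClosed (K : Set E) := Submodule.isClosed_topologicalClosure _
  have : CompleteSpace K := hKc.completeSpace_coe
  have hmem (n : ℕ) : (R ^ n) h ∈ K :=
    Submodule.le_topologicalClosure _ (Submodule.subset_span ⟨n, rfl⟩)
  -- Unitarity gives `⟪Rⁿ⁺ᵐ h, Rᵐ h⟫ = ⟪Rⁿ h, h⟫`, so the hypothesis covers the whole forward orbit.
  have horb : ∀ l ∈ S, Tendsto (fun n : ℕ => inner 𝕜 ((R ^ n) h) l) atTop (𝓝 0) := by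
    rintro _ ⟨m, rfl⟩
    rw [← tendsto_add_atTop_iff_nat m]
    refine hR.congr fun n => ?_
    have h1 : (R ^ (n + m)) h = (R ^ m) ((R ^ n) h) := by
      rw [add_comm, pow_add]
      rfl
    rw [h1, LinearIsometryEquiv.inner_map_map]
  -- The component of `k` orthogonal to the closed span of the orbit contributes nothing.
  obtain ⟨y, hy, z, hz, rfl⟩ := K.exists_add_mem_mem_orthogonal k
  refine (tendsto_inner_zero_of_mem_closure_span (C := ‖h‖) (fun n => by
    rw [LinearIsometryEquiv.norm_map]) horb hy).congr fun n => ?_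
  rw [inner_add_right, (Submodule.mem_orthogonal _ _).1 hz _ (hmem n), add_zero]

end Hilbert

/-! ### Mixing in terms of correlations in `L²` -/

section Mixing

variable {Ω : Type*} [MeasurableSpace Ω] {μ : Measure Ω} [IsProbabilityMeasure μ]
  {T : Ω → Ω}

/-- The constant function `1` in `L²`. -/
noncomputable def oneLp (𝕜 : Type*) [RCLike 𝕜] (μ : Measure Ω) [IsProbabilityMeasure μ] :
    Lp 𝕜 2 μ :=
  indicatorConstLp 2 MeasurableSet.univ (measure_ne_top μ _) 1

theorem span_indicatorConstLp_dense :
    (Submodule.span ℝ {f : Lp ℝ 2 μ | ∃ (s : Set Ω) (hs : MeasurableSet s),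
      f = indicatorConstLp 2 hs (measure_ne_top μ s) 1}).topologicalClosure = ⊤ := by
  rw [eq_top_iff]
  intro f _
  refine Lp.induction ENNReal.ofNat_ne_top (motive := fun f => f ∈ (Submodule.span ℝ
    {f : Lp ℝ 2 μ | ∃ (s : Set Ω) (hs : MeasurableSet s),
      f = indicatorConstLp 2 hs (measure_ne_top μ s) 1}).topologicalClosure) ?_ ?_ ?_ f
  · intro c s hs hμs
    have h1 : ((Lp.simpleFunc.indicatorConst 2 hs hμs.ne c : Lp.simpleFunc ℝ 2 μ) : Lp ℝ 2 μ)
        = c • indicatorConstLp 2 hs (measure_ne_top μ s) 1 := by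
      rw [Lp.simpleFunc.coe_indicatorConst]
      refine Lp.ext (indicatorConstLp_coeFn.trans ?_)
      filter_upwards [Lp.coeFn_smul c (indicatorConstLp 2 hs (measure_ne_top μ s) (1 : ℝ)),
        indicatorConstLp_coeFn (p := 2) (hs := hs) (hμs := measure_ne_top μ s) (c := (1 : ℝ))]
        with w h1 h2
      rw [h1, Pi.smul_apply, h2]
      by_cases hw : w ∈ s <;> simp [hw]
    rw [h1]
    exact Submodule.smul_mem _ _
      (Submodule.le_topologicalClosure _ (Submodule.subset_span ⟨s, hs, rfl⟩))
  · intro f g hf hg _ h1 h2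
    exact Submodule.add_mem _ h1 h2
  · exact Submodule.isClosed_topologicalClosure _

theorem inner_compMeasurePreserving_indicatorConstLp (𝕜 : Type*) [RCLike 𝕜]
    (hT : MeasurePreserving T μ μ) (n : ℕ) {A B : Set Ω} (hA : MeasurableSet A)
    (hB : MeasurableSet B) :
    inner 𝕜 (Lp.compMeasurePreserving T^[n] (hT.iterate n)
      (indicatorConstLp 2 hA (measure_ne_top μ A) (1 : 𝕜)))
      (indicatorConstLp 2 hB (measure_ne_top μ B) (1 : 𝕜))
      = (μ.real (T^[n] ⁻¹' A ∩ B) : 𝕜) := by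
  rw [Lp.indicatorConstLp_compMeasurePreserving,
    L2.inner_indicatorConstLp_one_indicatorConstLp_one]

/-- Decay of correlations in `L²` can be checked on a total set. -/
theorem tendsto_inner_compMeasurePreserving {𝕜 : Type*} [RCLike 𝕜]
    (hT : MeasurePreserving T μ μ) {S : Set (Lp 𝕜 2 μ)}
    (hS : (Submodule.span 𝕜 S).topologicalClosure = ⊤)
    (h : ∀ f ∈ S, ∀ g ∈ S, Tendsto (fun n => inner 𝕜 (Lp.compMeasurePreserving T^[n]
      (hT.iterate n) f) g) atTop (𝓝 (inner 𝕜 f (oneLp 𝕜 μ) * inner 𝕜 (oneLp 𝕜 μ) g)))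
    (f g : Lp 𝕜 2 μ) :
    Tendsto (fun n => inner 𝕜 (Lp.compMeasurePreserving T^[n] (hT.iterate n) f) g) atTop
      (𝓝 (inner 𝕜 f (oneLp 𝕜 μ) * inner 𝕜 (oneLp 𝕜 μ) g)) := by
  have hU (n : ℕ) (f : Lp 𝕜 2 μ) : Lp.compMeasurePreservingₗᵢ 𝕜 T^[n] (hT.iterate n) f
      = Lp.compMeasurePreserving T^[n] (hT.iterate n) f := rfl
  simp only [← hU] at h ⊢
  exact tendsto_inner_of_span_dense hS h f g

/-- The definition of mixing is this convergence for indicators, which are total. -/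
theorem IsMixing.tendsto_inner (hT : IsMixing T μ) (f g : Lp ℝ 2 μ) :
    Tendsto (fun n => inner ℝ (Lp.compMeasurePreserving T^[n]
      (hT.measurePreserving.iterate n) f) g) atTop
      (𝓝 (inner ℝ f (oneLp ℝ μ) * inner ℝ (oneLp ℝ μ) g)) := by
  refine tendsto_inner_compMeasurePreserving hT.measurePreserving span_indicatorConstLp_dense ?_ f g
  rintro _ ⟨A, hA, rfl⟩ _ ⟨B, hB, rfl⟩
  have h1 := (ENNReal.tendsto_toReal (by finiteness)).comp (hT.tendsto A B hA hB)
  rw [ENNReal.toReal_mul] at h1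
  have h2 : inner ℝ (indicatorConstLp 2 hA (measure_ne_top μ A) (1 : ℝ)) (oneLp ℝ μ)
      = μ.real A := by
    rw [oneLp, L2.real_inner_indicatorConstLp_one_indicatorConstLp_one, Set.inter_univ]
  have h3 : inner ℝ (oneLp ℝ μ) (indicatorConstLp 2 hB (measure_ne_top μ B) (1 : ℝ))
      = μ.real B := by
    rw [oneLp, L2.real_inner_indicatorConstLp_one_indicatorConstLp_one, Set.univ_inter]
  rw [h2, h3]
  refine h1.congr fun n => ?_
  exact (inner_compMeasurePreserving_indicatorConstLp ℝ hT.measurePreserving n hA hB).symm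

theorem isMixing_of_tendsto_inner (hT : MeasurePreserving T μ μ)
    (h : ∀ f g : Lp ℂ 2 μ, Tendsto (fun n => inner ℂ (Lp.compMeasurePreserving T^[n]
      (hT.iterate n) f) g) atTop (𝓝 (inner ℂ f (oneLp ℂ μ) * inner ℂ (oneLp ℂ μ) g))) :
    IsMixing T μ := by
  refine ⟨hT, fun A B hA hB => ?_⟩
  have h1 := h (indicatorConstLp 2 hA (measure_ne_top μ A) 1)
    (indicatorConstLp 2 hB (measure_ne_top μ B) 1)
  have hpre (n : ℕ) :=
    inner_compMeasurePreserving_indicatorConstLp ℂ hT n hA hB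
  simp only [hpre] at h1
  rw [oneLp, L2.inner_indicatorConstLp_one_indicatorConstLp_one,
    L2.inner_indicatorConstLp_one_indicatorConstLp_one, Set.inter_univ, Set.univ_inter] at h1
  have h2 := ((RCLike.continuous_re (K := ℂ)).tendsto _).comp h1
  rw [← RCLike.ofReal_mul, RCLike.ofReal_re] at h2
  rw [← ENNReal.tendsto_toReal_iff (fun _ => by finiteness) (by finiteness), ENNReal.toReal_mul]
  exact h2.congr fun n => RCLike.ofReal_re _

end Mixing

/-! ### Means and iterates of Wiener integrals and their exponentials -/

variable {μ : Measure Path0} [IsProbabilityMeasure μ]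

theorem inner_oneLp_deltaIsometry (hμ : IsWienerMeasure μ) (h : H) :
    inner ℝ (oneLp ℝ μ) (deltaIsometry hμ h) = 0 := by
  refine denseRange_kerSum.induction_on h (isClosed_eq
    (continuous_const.inner (deltaIsometry hμ).continuous) continuous_const) fun a => ?_
  rw [oneLp, L2.inner_indicatorConstLp_one, Measure.restrict_univ, deltaIsometry_kerSum,
    ← integral_evalSum hμ a]
  exact integral_congr_ae (coeFn_stepIntegral hμ a)

/-- As the constant `1` is itself an exponential, `inner_expDelta` also computes the means. -/
theorem expDelta_zero (hμ : IsWienerMeasure μ) : expDelta hμ 0 = oneLp ℂ μ := by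
  refine Lp.ext ((coeFn_expDelta hμ 0).trans (EventuallyEq.trans ?_ indicatorConstLp_coeFn.symm))
  rw [map_zero]
  exact ae_of_all _ fun w => by simp

theorem IsRotation.compMeasurePreserving_iterate_expDelta {hμ : IsWienerMeasure μ}
    {R : H ≃ₗᵢ[ℝ] H} {e : HilbertBasis ℕ ℝ H} {T : Path0 → Path0} (hT : IsRotation hμ R e T)
    (n : ℕ) (h : H) :
    Lp.compMeasurePreserving T^[n] (hT.measurePreserving.iterate n) (expDelta hμ h)
      = expDelta hμ ((R ^ n) h) := by
  have hq := (hT.measurePreserving.iterate n).quasiMeasurePreserving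
  have h1 := Lp.coeFn_compMeasurePreserving (deltaIsometry hμ h) (hT.measurePreserving.iterate n)
  rw [hT.compMeasurePreserving_iterate_deltaIsometry] at h1
  refine Lp.ext ((Lp.coeFn_compMeasurePreserving _ _).trans ?_)
  filter_upwards [h1, hq.ae_eq_comp (coeFn_expDelta hμ h), coeFn_expDelta hμ ((R ^ n) h)]
    with w h2 h3 h4
  rw [h3, h4, h2]
  rfl

end WienerRotation

open WienerRotation in
theorem theorem3 (μ : Measure Path0) (hμ : IsWienerMeasure μ)
    (R : H ≃ₗᵢ[ℝ] H) (e : HilbertBasis ℕ ℝ H)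
    (T : Path0 → Path0) (hT : IsRotation hμ R e T) :
    IsMixing T μ ↔ ∀ h : H, Tendsto (fun n : ℕ => inner ℝ ((R ^ n) h) h) atTop (𝓝 0) := by
  have := hμ.isGaussianProcess.isProbabilityMeasure
  constructor
  · intro hmix h
    have h1 := hmix.tendsto_inner (deltaIsometry hμ h) (deltaIsometry hμ h)
    simp only [hT.compMeasurePreserving_iterate_deltaIsometry, LinearIsometry.inner_map_map,
      inner_oneLp_deltaIsometry, mul_zero] at h1
    exact h1
  · intro hR
    -- Completeness of `H` is transported from `ℓ²` by the Hilbert basis.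
    have : CompleteSpace H := (completeSpace_congr e.repr.isometry.isUniformEmbedding
      (e := e.repr.toEquiv)).2 inferInstance
    refine isMixing_of_tendsto_inner hT.measurePreserving ?_
    refine tendsto_inner_compMeasurePreserving hT.measurePreserving (span_expDelta_dense hμ) ?_
    rintro _ ⟨h, rfl⟩ _ ⟨k, rfl⟩
    have h2 (n : ℕ) : ‖k - (R ^ n) h‖ ^ 2 = ‖k‖ ^ 2 - 2 * inner ℝ ((R ^ n) h) k + ‖h‖ ^ 2 := by
      rw [norm_sub_sq_real, LinearIsometryEquiv.norm_map, real_inner_comm]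
    simp only [hT.compMeasurePreserving_iterate_expDelta, ← expDelta_zero hμ, inner_expDelta, h2]
    rw [← Complex.exp_add]
    refine (Complex.continuous_exp.tendsto _).comp ?_
    -- Only the cross term depends on `n`; without it the exponent is `-(‖k‖² + ‖h‖²)/2`.
    have h3 := tendsto_inner_pow_of_tendsto_inner_self R (hR h) k
    have h4 := ((((h3.const_mul 2).const_sub (‖k‖ ^ 2)).add_const (‖h‖ ^ 2)).div_const 2).neg
    have h5 := (Complex.continuous_ofReal.tendsto _).comp h4
    refine (h5.congr fun n => ?_).trans (le_of_eq ?_)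
    · simp
    · congr 1
      simp only [zero_sub, norm_neg, sub_zero]
      push_cast
      ring
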